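/- For positive integers $b,c$ let $\mathbb{H}_{\mathbb{Q}}(-b,-c)$ be the generalized quaternion algebra over $\mathbb{Q}$ with basis $1,e_2,e_3,e_4$, where $e_2^2=-b$, $e_3^2=-c$ and $e_4=e_2e_3=-e_3e_2$. For $x=x_1+x_2e_2+x_3e_3+x_4e_4$ with $x_i\in\mathbb{Q}$ put $\overline{x}=x_1-x_2e_2-x_3e_3-x_4e_4$; the norm of $x$ is the rational number $n(x)=x\,\overline{x}=x_1^2+bx_2^2+cx_3^2+bcx_4^2$. Proposition 3.4. If $(b,c)\in\{(1,1),(1,2),(1,3),(2,2),(2,3),(2,4),(2,5)\}$, then the norm map $n$ is a surjection from $\mathbb{H}_{\mathbb{Q}}(-b,-c)$ onto the set of nonnegative rational numbers, and its restriction to the nonzero elements of $\mathbb{H}_{\mathbb{Q}}(-b,-c)$ is a surjection onto the set of positive rational numbers. -/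

import Mathlib

open scoped Quaternion

/-- The generalized quaternion algebra `ℍ_ℚ(-b, -c)` over `ℚ`, with basis `1, e₂, e₃, e₄ = e₂ e₃` and
`e₂² = -b`, `e₃² = -c`, `e₃ e₂ = -e₂ e₃`; the coordinates `x₁, x₂, x₃, x₄` of `x` are
`x.re, x.imI, x.imJ, x.imK`. -/
abbrev RatQuat (b c : ℕ) : Type := ℍ[ℚ, -(b : ℚ), -(c : ℚ)]

/-- The norm `n(x) = x * conj x`, read as a rational number (the conjugate of `x` is `star x`, and
`x * star x` has zero imaginary part, see `RatQuat.coe_norm`). -/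
def RatQuat.norm {b c : ℕ} (x : RatQuat b c) : ℚ := (x * star x).re

theorem RatQuat.coe_norm {b c : ℕ} (x : RatQuat b c) :
    ((RatQuat.norm x : ℚ) : RatQuat b c) = x * star x :=
  (QuaternionAlgebra.mul_star_eq_coe x).symm

theorem RatQuat.norm_eq {b c : ℕ} (x : RatQuat b c) :
    RatQuat.norm x = x.re ^ 2 + b * x.imI ^ 2 + c * x.imJ ^ 2 + b * c * x.imK ^ 2 := by
  simp [RatQuat.norm]
  ring

/-! The norm is multiplicative and sends a rational `q` to `q ^ 2`, so its values are closed under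
products and inverses; it suffices to reach each prime. An odd prime `p` has a multiple `k * p = x ^
2 + b * y ^ 2 + c` with `0 < k < p`, the norm of `x + y e₂ + e₃`. By strong induction `k` is a norm,
hence so is `p`: division in `ℚ` replaces Lagrange's descent. -/

open Polynomial in
/-- A diagonal binary quadratic form `X ^ 2 + b * Y ^ 2` with `b ≠ 0` represents every element of a
finite field of odd cardinality. -/
theorem FiniteField.exists_sq_add_mul_sq_add_eq_zero {F : Type*} [Field F] [Fintype F]
    (hF : Fintype.card F % 2 = 1) {b : F} (hb : b ≠ 0) (c : F) :
    ∃ x y : F, x ^ 2 + b * y ^ 2 + c = 0 := by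
  have hf : (X ^ 2 : F[X]).degree = 2 := by simp
  have hg : (C b * X ^ 2 + C 0 * X + C c : F[X]).degree = 2 := degree_quadratic hb
  obtain ⟨x, y, h⟩ := FiniteField.exists_root_sum_quadratic hf hg hF
  refine ⟨x, y, ?_⟩
  simp only [eval_add, eval_mul, eval_pow, eval_X, eval_C] at h
  linear_combination h

/-- An odd prime `p` has a multiple `k * p` with `0 < k < p` of the form `x ^ 2 + b * y ^ 2 + c`, for
`b ∈ {1, 2}` and `1 ≤ c ≤ 5`. -/
theorem Nat.Prime.exists_sq_add_mul_sq_add_eq_mul {p b c : ℕ} (hp : p.Prime) (hp2 : p ≠ 2)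
    (hb₀ : 0 < b) (hb : b ≤ 2) (hc₀ : 0 < c) (hc : c ≤ 5) :
    ∃ (x y : ℤ) (k : ℕ), 0 < k ∧ k < p ∧ x ^ 2 + b * y ^ 2 + c = k * p := by
  have := Fact.mk hp
  have hodd : p % 2 = 1 := hp.eq_two_or_odd.resolve_left hp2
  have h3 : 3 ≤ p := by have := hp.two_le; omega
  have hbp : (b : ZMod p) ≠ 0 := fun h ↦ by
    have := Nat.le_of_dvd hb₀ ((ZMod.natCast_eq_zero_iff b p).1 h)
    omega
  obtain ⟨x, y, hxy⟩ := FiniteField.exists_sq_add_mul_sq_add_eq_zero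
    (by rwa [ZMod.card]) hbp (c : ZMod p)
  -- As `p` is odd, least absolute residues are at most `(p - 1) / 2` in size.
  have key (z : ZMod p) : 4 * z.valMinAbs ^ 2 ≤ ((p : ℤ) - 1) ^ 2 := by
    have h₁ := z.natAbs_valMinAbs_le
    have h₂ : (2 * z.valMinAbs) ^ 2 ≤ ((p : ℤ) - 1) ^ 2 :=
      sq_le_sq' (by omega) (by omega)
    linarith
  have hdvd : (p : ℤ) ∣ x.valMinAbs ^ 2 + b * y.valMinAbs ^ 2 + c := by
    rw [← ZMod.intCast_zmod_eq_zero_iff_dvd]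
    push_cast [ZMod.coe_valMinAbs]
    exact hxy
  obtain ⟨k, hk⟩ := hdvd
  have hp₀ : (0 : ℤ) < p := by omega
  have hk₀ : 0 < k := by
    refine pos_of_mul_pos_right ?_ hp₀.le
    rw [← hk]
    positivity
  -- `k * p ≤ 3 * (p - 1) ^ 2 / 4 + 5 < p ^ 2` for `p ≥ 3`; at `p = 3` this reads `8 < 9`, so the
  -- bound 5 on `c` is tight here.
  have hkp : k < p := by
    have hby : (b : ℤ) * y.valMinAbs ^ 2 ≤ 2 * y.valMinAbs ^ 2 := by
      gcongr
      exact_mod_cast hb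
    have hx := key x
    have hy := key y
    have hc' : (c : ℤ) ≤ 5 := by exact_mod_cast hc
    have h3' : (3 : ℤ) ≤ p := by exact_mod_cast h3
    by_contra! hle
    have : (p : ℤ) * p ≤ p * k := by gcongr
    nlinarith
  lift k to ℕ using hk₀.le
  exact ⟨_, _, k, by exact_mod_cast hk₀, by exact_mod_cast hkp, by rw [hk, mul_comm]⟩

namespace RatQuat

variable {b c : ℕ}

theorem norm_mul (x y : RatQuat b c) : norm (x * y) = norm x * norm y := by
  simp only [norm_eq, QuaternionAlgebra.re_mul, QuaternionAlgebra.imI_mul,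
    QuaternionAlgebra.imJ_mul, QuaternionAlgebra.imK_mul]
  ring

theorem norm_coe (q : ℚ) : norm (q : RatQuat b c) = q ^ 2 := by
  simp [norm_eq]

theorem norm_nonneg (x : RatQuat b c) : 0 ≤ norm x := by
  rw [norm_eq]
  positivity

theorem norm_eq_zero (hb : 0 < b) (hc : 0 < c) {x : RatQuat b c} : norm x = 0 ↔ x = 0 := by
  refine ⟨fun h ↦ ?_, fun h ↦ by simp [h, norm]⟩
  have hb' : (0 : ℚ) < b := by exact_mod_cast hb
  have hc' : (0 : ℚ) < c := by exact_mod_cast hc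
  rw [norm_eq, add_eq_zero_iff_of_nonneg (by positivity) (by positivity),
    add_eq_zero_iff_of_nonneg (by positivity) (by positivity),
    add_eq_zero_iff_of_nonneg (by positivity) (by positivity)] at h
  obtain ⟨⟨⟨h₁, h₂⟩, h₃⟩, h₄⟩ := h
  ext
  · simpa using h₁
  · simpa [hb'.ne'] using h₂
  · simpa [hc'.ne'] using h₃
  · simpa [hb'.ne', hc'.ne'] using h₄

theorem mul_mem_range_norm {q r : ℚ} (hq : q ∈ Set.range (norm : RatQuat b c → ℚ))
    (hr : r ∈ Set.range (norm : RatQuat b c → ℚ)) :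
    q * r ∈ Set.range (norm : RatQuat b c → ℚ) := by
  obtain ⟨x, rfl⟩ := hq
  obtain ⟨y, rfl⟩ := hr
  exact ⟨x * y, norm_mul x y⟩

theorem inv_mem_range_norm {q : ℚ} (hq : q ∈ Set.range (norm : RatQuat b c → ℚ)) :
    q⁻¹ ∈ Set.range (norm : RatQuat b c → ℚ) := by
  rcases eq_or_ne q 0 with rfl | h
  · simpa using hq
  -- Inverses agree with `q` up to a square, and squares are norms of scalars.
  · have : q⁻¹ = q * q⁻¹ ^ 2 := by field_simp
    rw [this]
    exact mul_mem_range_norm hq ⟨_, norm_coe q⁻¹⟩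

theorem natCast_mem_range_norm (hb₀ : 0 < b) (hb : b ≤ 2) (hc₀ : 0 < c) (hc : c ≤ 5) (n : ℕ) :
    (n : ℚ) ∈ Set.range (norm : RatQuat b c → ℚ) := by
  induction n using Nat.strong_induction_on with
  | _ n ih =>
  rcases Nat.lt_or_ge n 2 with h | h2
  · interval_cases n
    · exact ⟨0, by simp [norm]⟩
    · exact ⟨1, by simp [norm]⟩
  by_cases hn : n.Prime
  · rcases eq_or_ne n 2 with rfl | hn2
    · interval_cases b
      · exact ⟨⟨1, 1, 0, 0⟩, by rw [norm_eq]; norm_num⟩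
      · exact ⟨⟨0, 1, 0, 0⟩, by rw [norm_eq]; norm_num⟩
    · obtain ⟨x, y, k, hk₀, hkn, hk⟩ :=
        hn.exists_sq_add_mul_sq_add_eq_mul hn2 hb₀ hb hc₀ hc
      have hk' : (x : ℚ) ^ 2 + b * y ^ 2 + c = k * n := by exact_mod_cast hk
      have hmul : (k * n : ℚ) ∈ Set.range (norm : RatQuat b c → ℚ) :=
        ⟨⟨x, y, 1, 0⟩, by rw [norm_eq, ← hk']; ring⟩
      have hk0 : (k : ℚ) ≠ 0 := by exact_mod_cast hk₀.ne'
      rw [← inv_mul_cancel_left₀ hk0 (n : ℚ)]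
      exact mul_mem_range_norm (inv_mem_range_norm (ih k hkn)) hmul
  · obtain ⟨d, e, hd, he, rfl⟩ := (Nat.not_prime_iff_exists_mul_eq h2).1 hn
    rw [Nat.cast_mul]
    exact mul_mem_range_norm (ih d hd) (ih e he)

theorem range_norm (hb₀ : 0 < b) (hb : b ≤ 2) (hc₀ : 0 < c) (hc : c ≤ 5) :
    Set.range (norm : RatQuat b c → ℚ) = Set.Ici 0 := by
  refine Set.Subset.antisymm (Set.range_subset_iff.2 norm_nonneg) fun q hq ↦ ?_
  lift q to ℚ≥0 using hq
  rw [← NNRat.num_div_den q]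
  push_cast
  rw [div_eq_mul_inv]
  exact mul_mem_range_norm (natCast_mem_range_norm hb₀ hb hc₀ hc _)
    (inv_mem_range_norm (natCast_mem_range_norm hb₀ hb hc₀ hc _))

theorem image_norm_ne_zero (hb₀ : 0 < b) (hb : b ≤ 2) (hc₀ : 0 < c) (hc : c ≤ 5) :
    (norm : RatQuat b c → ℚ) '' {x | x ≠ 0} = Set.Ioi 0 := by
  ext q
  constructor
  · rintro ⟨x, hx, rfl⟩
    exact (norm_nonneg x).lt_of_ne' (mt (norm_eq_zero hb₀ hc₀).1 hx)
  · intro hq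
    obtain ⟨x, rfl⟩ := (range_norm hb₀ hb hc₀ hc).ge (Set.mem_Ici.2 (le_of_lt hq))
    exact ⟨x, fun h ↦ (ne_of_gt hq) ((norm_eq_zero hb₀ hc₀).2 h), rfl⟩

end RatQuat

theorem proposition3p4 (b c : ℕ)
    (hbc : (b, c) ∈
      ({(1, 1), (1, 2), (1, 3), (2, 2), (2, 3), (2, 4), (2, 5)} : Set (ℕ × ℕ))) :
    Set.range (RatQuat.norm : RatQuat b c → ℚ) = Set.Ici 0 ∧
      (RatQuat.norm : RatQuat b c → ℚ) '' {x | x ≠ 0} = Set.Ioi 0 := by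
  obtain ⟨hb₀, hb, hc₀, hc⟩ : 0 < b ∧ b ≤ 2 ∧ 0 < c ∧ c ≤ 5 := by
    simp only [Set.mem_insert_iff, Set.mem_singleton_iff, Prod.mk.injEq] at hbc
    omega
  exact ⟨RatQuat.range_norm hb₀ hb hc₀ hc, RatQuat.image_norm_ne_zero hb₀ hb hc₀ hc⟩
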